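/- Let $R$ be an associative ring with $1$ and let $E$ be a directed graph (loops, parallel edges and infinitely many edges allowed) with finite vertex set $E^0$, edge set $E^1$, source map $s$ and range map $r$. The Cohn path ring $C_R(E)$ is the unital ring generated by $R$ together with $E^0\cup E^1\cup\{e^*: e\in E^1\}$, where the elements of $R$ commute with all of the other generators, subject to the relations of $R$ and: $vw=\delta_{v,w}v$ for $v,w\in E^0$; $e=s(e)e=e\,r(e)$ and $e^*=r(e)e^*=e^*s(e)$ for $e\in E^1$; $e^*f=\delta_{e,f}\,r(e)$ for $e,f\in E^1$; and $\sum_{v\in E^0}v=1$. All modules are right modules. A ring $S$ satisfies the strong rank condition if, for every positive integer $n$, there is no injective $S$-module homomorphism $S^{n+1}\to S^n$. For vertices, write $v\ge w$ if there is a path (possibly of length $0$) from $v$ to $w$. A set $X\subseteq E^0$ is hereditary if $x\in X$ and $x\ge v$ imply $v\in X$. A cycle is a path $(e_1,\dots,e_n)$ with $n>0$, $r(e_n)=s(e_1)$ and $s(e_1),\dots,s(e_n)$ pairwise distinct. For cycles, write $\omega\ge\xi$ if there is a path from a vertex of $\omega$ to a vertex of $\xi$; a cycle $\omega$ is maximal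 if $\xi\ge\omega$ implies $\omega\ge\xi$ for every cycle $\xi$. A cycle is exclusive if it shares no vertex with any other cycle, where cycles that are cyclic rotations of each other are regarded as the same. Let $X$ be the smallest hereditary subset of $E^0$ that contains all the vertices of all the cycles of $E$. Then the following are equivalent: (i) $C_R(E)$ satisfies the strong rank condition; (ii) $R$ satisfies the strong rank condition, and there is no injective $C_R(E)$-module homomorphism $C_R(E)\oplus C_R(E)\to C_R(E)$; (iii) $R$ satisfies the strong rank condition, and at least one of the following holds: (1) $X\ne E^0$; (2) $E$ contains an exclusive maximal cycle. -/

import Mathlib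

open Function

/-- A directed graph with vertex set `V`, edge set `E`, source map `s` and range map `r`.
Loops, parallel edges and infinitely many edges are allowed. -/
structure DirectedGraph (V : Type*) (E : Type*) where
  s : E → V
  r : E → V

namespace DirectedGraph

variable {V : Type*} {E : Type*} (G : DirectedGraph V E)

/-- `G.IsPath v p w`: the sequence of edges `p` is a path with source `v` and range `w`.
The empty sequence is the path of length zero at a vertex. -/
def IsPath : V → List E → V → Prop
  | v, [], w => v = w
  | v, e :: p, w => G.s e = v ∧ IsPath (G.r e) p w

/-- The quasiordering on vertices: `v ≥ w` if there is a path from `v` to `w`. -/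
def Reaches (v w : V) : Prop := ∃ p : List E, G.IsPath v p w

/-- A set of vertices is hereditary if it contains every `v` with `x ≥ v` for some member `x`. -/
def IsHereditary (X : Set V) : Prop := ∀ x ∈ X, ∀ v, G.Reaches x v → v ∈ X

/-- A cycle: a closed path of positive length whose edges have pairwise distinct sources. -/
def IsCycle (c : List E) : Prop :=
  c ≠ [] ∧ (∃ v, G.IsPath v c v) ∧ (c.map G.s).Nodup

/-- The set of vertices on a path of positive length. -/
def vert (p : List E) : Set V := {v | ∃ e ∈ p, v = G.s e ∨ v = G.r e}

/-- The set of all the vertices of all the cycles. -/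
def cycleVertices : Set V := {v | ∃ c, G.IsCycle c ∧ v ∈ G.vert c}

/-- The smallest hereditary set of vertices that contains all the vertices of all the cycles. -/
def cycleHereditaryClosure : Set V := ⋂₀ {X | G.IsHereditary X ∧ G.cycleVertices ⊆ X}

theorem isLeast_cycleHereditaryClosure :
    IsLeast {X | G.IsHereditary X ∧ G.cycleVertices ⊆ X} G.cycleHereditaryClosure :=
  ⟨⟨fun x hx v hv X hX => hX.1 x (hx X hX) v hv, fun _ hx _ hX => hX.2 hx⟩,
    fun _ hX _ hx => hx _ hX⟩

/-- The quasiordering on cycles induced by the one on vertices: `c ≥ d` if there is a path from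
a vertex of `c` to a vertex of `d`. -/
def CycleReaches (c d : List E) : Prop := ∃ v ∈ G.vert c, ∃ w ∈ G.vert d, G.Reaches v w

/-- A cycle that is maximal with respect to the quasiordering on cycles. -/
def IsMaximalCycle (c : List E) : Prop :=
  G.IsCycle c ∧ ∀ d, G.IsCycle d → G.CycleReaches d c → G.CycleReaches c d

/-- A cycle is exclusive if it shares no vertex with any other cycle. Here cycles that differ
only in the choice of the basepoint, i.e. by a cyclic rotation, count as the same cycle. -/
def IsExclusiveCycle (c : List E) : Prop :=
  G.IsCycle c ∧ ∀ d, G.IsCycle d → (G.vert c ∩ G.vert d).Nonempty → d.IsRotated c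

/-- Generators of the Cohn path ring: the elements of the coefficient ring, the vertices,
the edges and the ghost edges. -/
inductive CohnGen (R : Type*) (V : Type*) (E : Type*)
  | coeff (a : R) : CohnGen R V E
  | vertex (v : V) : CohnGen R V E
  | edge (e : E) : CohnGen R V E
  | ghost (e : E) : CohnGen R V E

section Relations

variable (R : Type*) [Ring R]

/-- The generator `a` of the free ring, for `a` in the coefficient ring. -/
def fCoeff (V : Type*) (E : Type*) {R : Type*} (a : R) : FreeRing (CohnGen R V E) :=
  FreeRing.of (.coeff a)

/-- The generator `v` of the free ring. -/
def fVertex (R : Type*) {V : Type*} (E : Type*) (v : V) : FreeRing (CohnGen R V E) :=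
  FreeRing.of (.vertex v)

/-- The generator `e` of the free ring. -/
def fEdge (R : Type*) (V : Type*) {E : Type*} (e : E) : FreeRing (CohnGen R V E) :=
  FreeRing.of (.edge e)

/-- The generator `e⋆` of the free ring. -/
def fGhost (R : Type*) (V : Type*) {E : Type*} (e : E) : FreeRing (CohnGen R V E) :=
  FreeRing.of (.ghost e)

/-- The defining relations of the Cohn path ring. The first three say that `a ↦ a` is a ring
homomorphism from `R` (so that the quotient is an `R`-ring), the next three that
coefficients commute with the other generators. -/
inductive CohnRel [Fintype V] :
    FreeRing (CohnGen R V E) → FreeRing (CohnGen R V E) → Prop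
  | coeff_one : CohnRel (fCoeff V E (1 : R)) 1
  | coeff_add (a b : R) : CohnRel (fCoeff V E (a + b)) (fCoeff V E a + fCoeff V E b)
  | coeff_mul (a b : R) : CohnRel (fCoeff V E (a * b)) (fCoeff V E a * fCoeff V E b)
  | coeff_vertex (a : R) (v : V) :
      CohnRel (fCoeff V E a * fVertex R E v) (fVertex R E v * fCoeff V E a)
  | coeff_edge (a : R) (e : E) :
      CohnRel (fCoeff V E a * fEdge R V e) (fEdge R V e * fCoeff V E a)
  | coeff_ghost (a : R) (e : E) :
      CohnRel (fCoeff V E a * fGhost R V e) (fGhost R V e * fCoeff V E a)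
  | vertex_self (v : V) : CohnRel (fVertex R E v * fVertex R E v) (fVertex R E v)
  | vertex_ne (v w : V) (h : v ≠ w) : CohnRel (fVertex R E v * fVertex R E w) 0
  | source_edge (e : E) : CohnRel (fVertex R E (G.s e) * fEdge R V e) (fEdge R V e)
  | edge_range (e : E) : CohnRel (fEdge R V e * fVertex R E (G.r e)) (fEdge R V e)
  | sum_vertex : CohnRel (∑ v : V, fVertex R E v) 1
  | range_ghost (e : E) : CohnRel (fVertex R E (G.r e) * fGhost R V e) (fGhost R V e)
  | ghost_source (e : E) : CohnRel (fGhost R V e * fVertex R E (G.s e)) (fGhost R V e)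
  | ghost_edge_self (e : E) : CohnRel (fGhost R V e * fEdge R V e) (fVertex R E (G.r e))
  | ghost_edge_ne (e f : E) (h : e ≠ f) : CohnRel (fGhost R V e * fEdge R V f) 0

/-- The Cohn path ring `C_R(G)`: the unital ring given by the generators `CohnGen R V E` and
the relations `CohnRel`. -/
def CohnPathRing [Fintype V] : Type _ := RingQuot (G.CohnRel R)

noncomputable instance [Fintype V] : Ring (G.CohnPathRing R) :=
  inferInstanceAs (Ring (RingQuot (G.CohnRel R)))

end Relations

end DirectedGraph

/-- The (right) strong rank condition: for no positive integer `n` is there an injective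
homomorphism `R^(n+1) → R^n` of right `R`-modules. (A right `R`-module is a module over the
opposite ring.) -/
def RightStrongRankCondition (R : Type*) [Ring R] : Prop :=
  ∀ n : ℕ, 0 < n → ¬ ∃ f : (Fin (n + 1) → R) →ₗ[Rᵐᵒᵖ] (Fin n → R), Injective f

/-! Write `C` for the Cohn path ring. All three conditions are compared with the existence of a thin
vertex, one for which at most one edge enters each of its ancestors. `exists_isThin_iff` shows that
this is the graph condition in (iii): a source is thin, sources exist exactly when the hereditary
closure of the cycles is proper, and without sources, thin vertices come from exclusive maximal
cycles.

At most one path of each length ends at a thin vertex `v`. Let `C` act on the free right `R`-module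
on the paths into `v`. The entries of an `n × (n+1)` matrix over `C` lengthen paths by at most some
`d`. As the number of paths of length `< N` grows at most linearly in `N`, for a suitable `N` there
are more unknowns than equations over `R`, and the strong rank condition of `R` gives a nonzero
solution in this module. `realize` carries it into `C`: a path `p` goes to `p` times `gap`, the
element `v(1 - ∑ e e⋆)` over the finitely many edges `e` whose ghosts matter for the matrix. Acting
on the trivial path recovers the solution, so its image is nonzero.

If no vertex is thin, finiteness of the vertex set yields two paths into every vertex, all of one
common length and all distinct. By `e⋆f = δ r(e)` they give two elements of `C` that embed `C ⊕ C`
into `C`.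

Finally, the strong rank condition passes from `C` to `R`: `C` acts on a free right `R`-module in
which an element is determined by its value on one vector, and coefficients act coordinatewise. Both
modules are instances of `Tails.rep`. -/

namespace DirectedGraph

variable {V : Type*} {E : Type*} (G : DirectedGraph V E)

/-! ### Generators of the Cohn path ring -/

section Generators

variable (R : Type*) [Ring R] [Fintype V]

/-- The quotient map from the free ring. -/
noncomputable def mkHom : FreeRing (CohnGen R V E) →+* G.CohnPathRing R :=
  RingQuot.mkRingHom (G.CohnRel R)

theorem mkHom_surjective : Surjective (G.mkHom R) :=
  RingQuot.mkRingHom_surjective _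

variable {R} in
theorem mkHom_rel {x y : FreeRing (CohnGen R V E)} (h : G.CohnRel R x y) :
    G.mkHom R x = G.mkHom R y :=
  RingQuot.mkRingHom_rel h

/-- The coefficient homomorphism from `R` to the Cohn path ring. -/
noncomputable def coeff : R →+* G.CohnPathRing R where
  toFun a := G.mkHom R (fCoeff V E a)
  map_one' := by rw [G.mkHom_rel .coeff_one, map_one]
  map_mul' a b := by rw [G.mkHom_rel (.coeff_mul a b), map_mul]
  map_zero' := by
    -- No relation mentions the coefficient zero; additivity at `0 + 0` forces it to vanish.
    have h := G.mkHom_rel (.coeff_add (0 : R) 0)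
    rw [add_zero, map_add] at h
    exact left_eq_add.mp h
  map_add' a b := by rw [G.mkHom_rel (.coeff_add a b), map_add]

/-- The vertices in the Cohn path ring. -/
noncomputable def vertex (v : V) : G.CohnPathRing R := G.mkHom R (fVertex R E v)

/-- The edges in the Cohn path ring. -/
noncomputable def edge (e : E) : G.CohnPathRing R := G.mkHom R (fEdge R V e)

/-- The ghost edges in the Cohn path ring. -/
noncomputable def ghost (e : E) : G.CohnPathRing R := G.mkHom R (fGhost R V e)

theorem coeff_commute_vertex (a : R) (v : V) : Commute (G.coeff R a) (G.vertex R v) := by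
  have h := G.mkHom_rel (.coeff_vertex a v)
  rw [map_mul, map_mul] at h
  exact h

theorem coeff_commute_edge (a : R) (e : E) : Commute (G.coeff R a) (G.edge R e) := by
  have h := G.mkHom_rel (.coeff_edge a e)
  rw [map_mul, map_mul] at h
  exact h

theorem coeff_commute_ghost (a : R) (e : E) : Commute (G.coeff R a) (G.ghost R e) := by
  have h := G.mkHom_rel (.coeff_ghost a e)
  rw [map_mul, map_mul] at h
  exact h

@[simp] theorem vertex_mul_self (v : V) : G.vertex R v * G.vertex R v = G.vertex R v := by
  have h := G.mkHom_rel (R := R) (.vertex_self v)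
  rw [map_mul] at h
  exact h

variable {G} in
theorem vertex_mul_of_ne {v w : V} (h : v ≠ w) : G.vertex R v * G.vertex R w = 0 := by
  have h := G.mkHom_rel (R := R) (.vertex_ne v w h)
  rw [map_mul, map_zero] at h
  exact h

@[simp] theorem source_mul_edge (e : E) :
    G.vertex R (G.s e) * G.edge R e = G.edge R e := by
  have h := G.mkHom_rel (R := R) (.source_edge e)
  rw [map_mul] at h
  exact h

@[simp] theorem edge_mul_range (e : E) :
    G.edge R e * G.vertex R (G.r e) = G.edge R e := by
  have h := G.mkHom_rel (R := R) (.edge_range e)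
  rw [map_mul] at h
  exact h

@[simp] theorem range_mul_ghost (e : E) :
    G.vertex R (G.r e) * G.ghost R e = G.ghost R e := by
  have h := G.mkHom_rel (R := R) (.range_ghost e)
  rw [map_mul] at h
  exact h

@[simp] theorem ghost_mul_source (e : E) :
    G.ghost R e * G.vertex R (G.s e) = G.ghost R e := by
  have h := G.mkHom_rel (R := R) (.ghost_source e)
  rw [map_mul] at h
  exact h

@[simp] theorem ghost_mul_edge_self (e : E) :
    G.ghost R e * G.edge R e = G.vertex R (G.r e) := by
  have h := G.mkHom_rel (R := R) (.ghost_edge_self e)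
  rw [map_mul] at h
  exact h

variable {G} in
theorem ghost_mul_edge_of_ne {e f : E} (h : e ≠ f) : G.ghost R e * G.edge R f = 0 := by
  have h := G.mkHom_rel (R := R) (.ghost_edge_ne e f h)
  rw [map_mul, map_zero] at h
  exact h

theorem sum_vertex : ∑ v, G.vertex R v = 1 := by
  have h := G.mkHom_rel (R := R) .sum_vertex
  rw [map_sum, map_one] at h
  exact h

variable {G R} in
theorem ghost_mul_vertex_of_ne {e : E} {v : V} (h : G.s e ≠ v) :
    G.ghost R e * G.vertex R v = 0 := by
  rw [← ghost_mul_source, mul_assoc, vertex_mul_of_ne R h, mul_zero]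

variable {G R} in
theorem edge_mul_vertex_of_ne {e : E} {v : V} (h : G.r e ≠ v) :
    G.edge R e * G.vertex R v = 0 := by
  rw [← edge_mul_range, mul_assoc, vertex_mul_of_ne R h, mul_zero]

variable {G R} in
@[elab_as_elim]
theorem cohn_induction {P : G.CohnPathRing R → Prop} (x : G.CohnPathRing R)
    (coeff : ∀ a, P (G.coeff R a)) (vertex : ∀ v, P (G.vertex R v))
    (edge : ∀ e, P (G.edge R e)) (ghost : ∀ e, P (G.ghost R e))
    (add : ∀ x y, P x → P y → P (x + y)) (mul : ∀ x y, P x → P y → P (x * y)) : P x := by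
  obtain ⟨z, rfl⟩ := G.mkHom_surjective R x
  induction z using FreeRing.induction_on with
  | hn1 =>
    have h := coeff (-1)
    rw [map_neg, map_one] at h ⊢
    exact h
  | hb b =>
    cases b with
    | coeff a => exact coeff a
    | vertex v => exact vertex v
    | edge e => exact edge e
    | ghost e => exact ghost e
  | ha x y hx hy => rw [map_add]; exact add _ _ hx hy
  | hm x y hx hy => rw [map_mul]; exact mul _ _ hx hy

end Generators

/-! ### Transfer operators -/

section Transfer

variable (R : Type*) [Ring R] {B : Type*}

/-- The operator on a free module induced by a partial self-map of the basis. -/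
noncomputable def transfer (φ : B → Option B) : Module.End Rᵐᵒᵖ (B →₀ R) :=
  Finsupp.lsum ℕ fun b => (φ b).elim 0 fun b' => Finsupp.lsingle b'

variable {R}

theorem transfer_single (φ : B → Option B) (b : B) (a : R) :
    transfer R φ (Finsupp.single b a) = (φ b).elim 0 fun b' => Finsupp.single b' a := by
  rw [transfer, Finsupp.lsum_single]
  cases φ b <;> simp

theorem transfer_eq_sum (φ : B → Option B) (m : B →₀ R) :
    transfer R φ m = m.sum fun b a => (φ b).elim 0 fun b' => Finsupp.single b' a := by
  rw [transfer, Finsupp.lsum_apply]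
  refine Finsupp.sum_congr fun b _ => ?_
  cases φ b <;> simp

theorem end_ext {f g : Module.End Rᵐᵒᵖ (B →₀ R)}
    (h : ∀ b a, f (Finsupp.single b a) = g (Finsupp.single b a)) : f = g :=
  Finsupp.lhom_ext h

theorem transfer_mul (φ ψ : B → Option B) :
    transfer R φ * transfer R ψ = transfer R fun b => (ψ b).bind φ := by
  refine end_ext fun b a => ?_
  rw [Module.End.mul_apply, transfer_single, transfer_single]
  cases ψ b <;> simp [transfer_single]

theorem transfer_none : transfer R (fun _ : B => none) = 0 :=
  end_ext fun b a => by simp [transfer_single]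

theorem transfer_mem_supported (φ : B → Option B) {S T : Set B}
    (h : ∀ b ∈ S, ∀ b' ∈ φ b, b' ∈ T) {m : B →₀ R} (hm : m ∈ Finsupp.supported R R S) :
    transfer R φ m ∈ Finsupp.supported R R T := by
  rw [transfer_eq_sum]
  refine Submodule.sum_mem _ fun b hb => ?_
  have hbS : b ∈ S := hm hb
  dsimp only
  cases hφ : φ b with
  | none => exact Submodule.zero_mem _
  | some b' => exact Finsupp.single_mem_supported R _ (h b hbS b' hφ)

/-- Left multiplication by coefficients. -/
noncomputable def leftMul : R →+* Module.End Rᵐᵒᵖ (B →₀ R) :=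
  Module.toModuleEnd Rᵐᵒᵖ (S := R) (B →₀ R)

theorem leftMul_apply (a : R) (m : B →₀ R) : leftMul a m = a • m := rfl

theorem leftMul_mul_transfer (a : R) (φ : B → Option B) :
    leftMul a * transfer R φ = transfer R φ * leftMul a := by
  refine end_ext fun b c => ?_
  simp only [Module.End.mul_apply, leftMul_apply, transfer_single, Finsupp.smul_single]
  cases φ b <;> simp

end Transfer

/-! ### Representations on paths with tails -/

/-- A set of tails: each of them is based at a vertex, and the ghost edges act partially. -/
structure Tails (D : Type*) where
  base : D → V
  next : E → D → Option D
  base_of_next : ∀ {e d d'}, next e d = some d' → base d = G.s e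
  base_next : ∀ {e d d'}, next e d = some d' → base d' = G.r e

namespace Tails

variable {G} {D : Type*} (T : G.Tails D)

/-- The vertex at which a path with a tail starts. -/
def start : List E × D → V
  | ([], d) => T.base d
  | (e :: _, _) => G.s e

open Classical in
/-- The partial action of the vertices. -/
noncomputable def vertexStep (v : V) (b : List E × D) : Option (List E × D) :=
  if T.start b = v then some b else none

open Classical in
/-- The partial action of the edges. -/
noncomputable def edgeStep (e : E) (b : List E × D) : Option (List E × D) :=
  if T.start b = G.r e then some (e :: b.1, b.2) else none

open Classical in
/-- The partial action of the ghost edges. -/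
noncomputable def ghostStep (e : E) : List E × D → Option (List E × D)
  | ([], d) => (T.next e d).map fun d' => ([], d')
  -- The basis also contains lists that are not composable; for these the second condition is needed
  -- to keep `r(e) e⋆ = e⋆`.
  | (f :: p, d) => if f = e ∧ T.start (p, d) = G.r e then some (p, d) else none

variable (R : Type*) [Ring R]

/-- The action of the generators of the Cohn path ring. -/
noncomputable def genAct : CohnGen R V E → Module.End Rᵐᵒᵖ (List E × D →₀ R)
  | .coeff a => leftMul a
  | .vertex v => transfer R (T.vertexStep v)
  | .edge e => transfer R (T.edgeStep e)
  | .ghost e => transfer R (T.ghostStep e)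

variable [Fintype V]

/-- Apart from the relations on coefficients, each relation is an identity of partial self-maps of
the basis, except `sum_vertex`, which holds because every basis element starts at exactly one
vertex. -/
theorem genAct_rel {x y : FreeRing (CohnGen R V E)} (h : G.CohnRel R x y) :
    FreeRing.lift (T.genAct R) x = FreeRing.lift (T.genAct R) y := by
  classical
  cases h <;>
    simp only [fCoeff, fVertex, fEdge, fGhost, map_one, map_add, map_mul, map_sum, map_zero,
      FreeRing.lift_of, genAct, leftMul_mul_transfer, transfer_mul]
  case vertex_self v =>
    congr 1; funext b
    simp only [vertexStep]; split_ifs <;> simp_all [vertexStep]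
  case vertex_ne v w h =>
    rw [← transfer_none]
    congr 1; funext b
    simp only [vertexStep]; split_ifs <;> simp_all [vertexStep, eq_comm]
  case source_edge e =>
    congr 1; funext b
    simp only [edgeStep]; split_ifs <;> simp_all [vertexStep, start]
  case edge_range e =>
    congr 1; funext b
    simp only [edgeStep, vertexStep]; split_ifs <;> simp_all [edgeStep]
  case sum_vertex =>
    refine end_ext fun b a => ?_
    have h (v : V) : (T.vertexStep v b).elim 0 (fun b' => Finsupp.single b' a)
        = if T.start b = v then Finsupp.single b a else 0 := by
      simp only [vertexStep]; split_ifs <;> simp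
    simp [LinearMap.sum_apply, transfer_single, h]
  case range_ghost e =>
    congr 1; funext b
    obtain ⟨_ | ⟨f, p⟩, d⟩ := b
    · simp only [ghostStep]
      cases hd : T.next e d with
      | none => simp
      | some d' => simp [vertexStep, start, T.base_next hd]
    · simp only [ghostStep]; split_ifs <;> simp_all [vertexStep]
  case ghost_source e =>
    congr 1; funext b
    obtain ⟨_ | ⟨f, p⟩, d⟩ := b
    · by_cases h : T.base d = G.s e
      · simp [vertexStep, start, h]
      · cases hd : T.next e d with
        | none => simp [vertexStep, start, ghostStep, h, hd]
        | some d' => exact absurd (T.base_of_next hd) h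
    · by_cases h : G.s f = G.s e
      · simp [vertexStep, start, h]
      · have h' : f ≠ e := fun h' => h (h' ▸ rfl)
        simp [vertexStep, start, ghostStep, h, h']
  case ghost_edge_self e =>
    congr 1; funext b
    simp only [edgeStep, vertexStep]; split_ifs <;> simp_all [ghostStep]
  case ghost_edge_ne e f h =>
    rw [← transfer_none]
    congr 1; funext b
    simp only [edgeStep]; split_ifs <;> simp_all [ghostStep, eq_comm]

/-- The representation of the Cohn path ring on paths with tails. -/
noncomputable def rep : G.CohnPathRing R →+* Module.End Rᵐᵒᵖ (List E × D →₀ R) :=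
  RingQuot.lift ⟨FreeRing.lift (T.genAct R), fun _ _ h => T.genAct_rel R h⟩

theorem rep_mkHom (x : FreeRing (CohnGen R V E)) :
    T.rep R (G.mkHom R x) = FreeRing.lift (T.genAct R) x :=
  RingQuot.lift_mkRingHom_apply _ _ _

variable {R}

theorem rep_coeff (a : R) : T.rep R (G.coeff R a) = leftMul a :=
  (T.rep_mkHom R _).trans (FreeRing.lift_of _ _)

theorem rep_vertex (v : V) : T.rep R (G.vertex R v) = transfer R (T.vertexStep v) :=
  (T.rep_mkHom R _).trans (FreeRing.lift_of _ _)

theorem rep_edge (e : E) : T.rep R (G.edge R e) = transfer R (T.edgeStep e) :=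
  (T.rep_mkHom R _).trans (FreeRing.lift_of _ _)

theorem rep_ghost (e : E) : T.rep R (G.ghost R e) = transfer R (T.ghostStep e) :=
  (T.rep_mkHom R _).trans (FreeRing.lift_of _ _)

end Tails

/-! ### Products of edges along paths -/

section PathElements

variable (R : Type*) [Ring R] [Fintype V]

/-- The product of the edges of a path. -/
noncomputable def pathElt (p : List E) : G.CohnPathRing R := (p.map (G.edge R)).prod

@[simp] theorem pathElt_nil : G.pathElt R [] = 1 := rfl

@[simp] theorem pathElt_cons (e : E) (p : List E) :
    G.pathElt R (e :: p) = G.edge R e * G.pathElt R p := by simp [pathElt]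

theorem coeff_commute_pathElt (a : R) (p : List E) :
    Commute (G.coeff R a) (G.pathElt R p) := by
  induction p with
  | nil => exact Commute.one_right _
  | cons e p ih => rw [pathElt_cons]; exact (G.coeff_commute_edge R a e).mul_right ih

end PathElements

namespace Tails

variable {G} {D : Type*} (T : G.Tails D) {R : Type*} [Ring R] [Fintype V]

/-- The additive map into the Cohn path ring that extends a choice of values on the tails. -/
noncomputable def realize (τ : D → G.CohnPathRing R) :
    (List E × D →₀ R) →+ G.CohnPathRing R :=
  Finsupp.liftAddHom fun b =>
    (AddMonoidHom.mulLeft (G.pathElt R b.1 * τ b.2)).comp (G.coeff R).toAddMonoidHom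

theorem realize_single (τ : D → G.CohnPathRing R) (b : List E × D) (a : R) :
    realize τ (Finsupp.single b a) = G.pathElt R b.1 * τ b.2 * G.coeff R a := by
  simp [realize]

theorem start_mul (τ : D → G.CohnPathRing R) (hτ : ∀ d, G.vertex R (T.base d) * τ d = τ d)
    (b : List E × D) :
    G.vertex R (T.start b) * (G.pathElt R b.1 * τ b.2) = G.pathElt R b.1 * τ b.2 := by
  obtain ⟨_ | ⟨e, p⟩, d⟩ := b
  · simp [start, hτ]
  · simp [start, ← mul_assoc]

/-- Coefficients multiply on the right, so intertwining can be tested on basis elements. -/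
theorem realize_transfer (τ : D → G.CohnPathRing R) (x : G.CohnPathRing R)
    (φ : List E × D → Option (List E × D))
    (h : ∀ b, x * (G.pathElt R b.1 * τ b.2)
      = (φ b).elim 0 fun b' => G.pathElt R b'.1 * τ b'.2) (m : List E × D →₀ R) :
    x * realize τ m = realize τ (transfer R φ m) := by
  induction m using Finsupp.induction_linear with
  | zero => simp
  | add m m' hm hm' => rw [map_add, mul_add, hm, hm', map_add, map_add]
  | single b a =>
    rw [realize_single, ← mul_assoc, h, transfer_single]
    cases φ b <;> simp [realize_single]

/-- Realization intertwines the actions of each element of the ring, provided that finitely many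
ghost edges act on the values on the tails as they should. -/
theorem exists_realize_rep (x : G.CohnPathRing R) :
    ∃ F : Finset E, ∀ τ : D → G.CohnPathRing R,
      (∀ d, G.vertex R (T.base d) * τ d = τ d) →
      (∀ a d, Commute (G.coeff R a) (τ d)) →
      (∀ e ∈ F, ∀ d, G.ghost R e * τ d = (T.next e d).elim 0 τ) →
      ∀ m, x * realize τ m = realize τ (T.rep R x m) := by
  classical
  induction x using cohn_induction with
  | coeff a =>
    refine ⟨∅, fun τ _ hc _ m => ?_⟩
    rw [rep_coeff, leftMul_apply]
    induction m using Finsupp.induction_linear with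
    | zero => simp
    | add m m' hm hm' => rw [map_add, mul_add, hm, hm', smul_add, map_add]
    | single b c =>
      rw [realize_single, Finsupp.smul_single, realize_single, smul_eq_mul, map_mul,
        ← mul_assoc, ((G.coeff_commute_pathElt R a b.1).mul_right (hc a b.2)).eq, mul_assoc]
  | vertex v =>
    refine ⟨∅, fun τ hb _ _ m => ?_⟩
    rw [rep_vertex]
    refine realize_transfer τ _ _ (fun b => ?_) m
    rw [← T.start_mul τ hb, ← mul_assoc]
    by_cases h : T.start b = v
    · rw [h, vertex_mul_self, ← h, T.start_mul τ hb]; simp [vertexStep]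
    · rw [vertex_mul_of_ne R (Ne.symm h)]; simp [vertexStep, h]
  | edge e =>
    refine ⟨∅, fun τ hb _ _ m => ?_⟩
    rw [rep_edge]
    refine realize_transfer τ _ _ (fun b => ?_) m
    by_cases h : T.start b = G.r e
    · simp [edgeStep, h, mul_assoc]
    · rw [← T.start_mul τ hb, ← mul_assoc, edge_mul_vertex_of_ne (Ne.symm h)]
      simp [edgeStep, h]
  | ghost e =>
    -- Only a ghost edge that meets a bare tail uses the hypothesis on ghosts, so each occurrence of
    -- a ghost generator contributes one edge.
    refine ⟨{e}, fun τ hb _ hg m => ?_⟩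
    rw [rep_ghost]
    refine realize_transfer τ _ _ (fun b => ?_) m
    obtain ⟨_ | ⟨f, p⟩, d⟩ := b
    · rw [pathElt_nil, one_mul, hg e (Finset.mem_singleton_self e) d, ghostStep]
      cases T.next e d <;> simp
    · rw [pathElt_cons, mul_assoc, ← mul_assoc]
      by_cases h : f = e
      · subst h
        rw [ghost_mul_edge_self, ← T.start_mul τ hb (p, d), ← mul_assoc]
        by_cases h' : T.start (p, d) = G.r f
        · rw [h', vertex_mul_self, ← h', T.start_mul τ hb]; simp [ghostStep, h']
        · rw [vertex_mul_of_ne R (Ne.symm h')]; simp [ghostStep, h']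
      · rw [ghost_mul_edge_of_ne R (Ne.symm h)]; simp [ghostStep, h]
  | add x y hx hy =>
    obtain ⟨F, hF⟩ := hx
    obtain ⟨F', hF'⟩ := hy
    refine ⟨F ∪ F', fun τ hb hc hg m => ?_⟩
    rw [add_mul, hF τ hb hc fun e he => hg e (Finset.mem_union_left _ he),
      hF' τ hb hc fun e he => hg e (Finset.mem_union_right _ he), map_add, LinearMap.add_apply,
      map_add]
  | mul x y hx hy =>
    obtain ⟨F, hF⟩ := hx
    obtain ⟨F', hF'⟩ := hy
    refine ⟨F ∪ F', fun τ hb hc hg m => ?_⟩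
    rw [mul_assoc, hF' τ hb hc fun e he => hg e (Finset.mem_union_right _ he),
      hF τ hb hc fun e he => hg e (Finset.mem_union_left _ he), map_mul, Module.End.mul_apply]

end Tails

end DirectedGraph

/-! ### The strong rank condition -/

section StrongRank

variable {R : Type*} [Ring R]

/-- A larger source contains a free summand of rank one more than the target, embedded by extending
vectors by zero. -/
theorem RightStrongRankCondition.not_injective (h : RightStrongRankCondition R)
    {α β : Type*} [Fintype α] [Fintype β] (hβ : 0 < Fintype.card β)
    (hlt : Fintype.card β < Fintype.card α) (f : (α → R) →ₗ[Rᵐᵒᵖ] (β → R)) : ¬ Injective f := by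
  intro hf
  obtain ⟨g⟩ : Nonempty (Fin (Fintype.card β + 1) ↪ α) :=
    Function.Embedding.nonempty_of_card_le (by simpa using hlt)
  let ext : (Fin (Fintype.card β + 1) → R) →ₗ[Rᵐᵒᵖ] (α → R) :=
    { toFun := fun x => Function.extend g x 0
      map_add' := fun x y => by
        simpa using Function.extend_add g x y (0 : α → R) 0
      map_smul' := fun c x => by
        simpa using Function.extend_smul c g x (0 : α → R) }
  have hext : Injective ext := Function.extend_injective g.injective _
  refine h _ hβ ⟨LinearMap.funLeft Rᵐᵒᵖ R (Fintype.equivFin β).symm ∘ₗ f ∘ₗ ext, ?_⟩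
  exact (LinearMap.funLeft_injective_of_surjective Rᵐᵒᵖ R _ (Equiv.surjective _)).comp
    (hf.comp hext)

theorem rightStrongRankCondition_iff_matrix :
    RightStrongRankCondition R ↔ ∀ n : ℕ, 0 < n →
      ∀ A : Matrix (Fin n) (Fin (n + 1)) R, ∃ x : Fin (n + 1) → R, x ≠ 0 ∧ A.mulVec x = 0 := by
  constructor
  · intro h n hn A
    let f : (Fin (n + 1) → R) →ₗ[Rᵐᵒᵖ] (Fin n → R) :=
      { toFun := A.mulVec
        map_add' := A.mulVec_add
        map_smul' := fun c x => A.mulVec_smul c x }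
    have hf : ¬ Injective f := fun hf => h n hn ⟨f, hf⟩
    rw [injective_iff_map_eq_zero] at hf
    push Not at hf
    obtain ⟨x, hx, hx0⟩ := hf
    exact ⟨x, hx0, hx⟩
  · rintro h n hn ⟨f, hf⟩
    obtain ⟨x, hx0, hx⟩ := h n hn fun i j => f (Pi.single j 1) i
    refine hx0 (hf ?_)
    rw [map_zero, ← hx]
    -- Right linearity: `x` is the sum of the basis vectors times its coordinates on the right, so
    -- the matrix of the images of the basis vectors acts on `x` as `f` does.
    have hx' : x = ∑ j, MulOpposite.op (x j) • (Pi.single j 1 : Fin (n + 1) → R) := by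
      funext i
      simp [Finset.sum_apply, Pi.single_apply]
    conv_lhs => rw [hx', map_sum]
    funext i
    simp [Finset.sum_apply, Matrix.mulVec, dotProduct]

/-- A system of linear operators that maps few basis vectors into the span of not too many
has a nontrivial solution. -/
theorem RightStrongRankCondition.exists_supported_ker (h : RightStrongRankCondition R)
    {B ι κ : Type*} [Fintype ι] [Fintype κ] (S S' : Finset B)
    (hpos : 0 < Fintype.card κ * S'.card)
    (hlt : Fintype.card κ * S'.card < Fintype.card ι * S.card)
    (A : κ → ι → Module.End Rᵐᵒᵖ (B →₀ R))
    (hA : ∀ k i, ∀ m ∈ Finsupp.supported R R (S : Set B),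
      A k i m ∈ Finsupp.supported R R (S' : Set B)) :
    ∃ m : ι → B →₀ R, (∀ i, m i ∈ Finsupp.supported R R (S : Set B)) ∧ m ≠ 0 ∧
      ∀ k, ∑ i, A k i (m i) = 0 := by
  classical
  let g (i : ι) : (ι × S → R) →ₗ[Rᵐᵒᵖ] (B →₀ R) :=
    ∑ b : S, Finsupp.lsingle b.1 ∘ₗ LinearMap.proj (i, b)
  have hg (i : ι) (x : ι × S → R) : g i x = ∑ b : S, Finsupp.single b.1 (x (i, b)) := by
    simp [g, LinearMap.sum_apply]
  have hgS (i : ι) (x : ι × S → R) : g i x ∈ Finsupp.supported R R (S : Set B) := by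
    rw [hg]
    exact Submodule.sum_mem _ fun b _ => Finsupp.single_mem_supported R _ b.2
  -- Only the coordinates in `S'` are recorded as equations; the remaining ones vanish by `hA`.
  let f : (ι × S → R) →ₗ[Rᵐᵒᵖ] (κ × S' → R) :=
    LinearMap.pi fun kb => Finsupp.lapply kb.2.1 ∘ₗ ∑ i, A kb.1 i ∘ₗ g i
  have hf : ¬ Injective f := h.not_injective (by simpa using hpos) (by simpa using hlt) f
  rw [injective_iff_map_eq_zero] at hf
  push Not at hf
  obtain ⟨x, hx, hx0⟩ := hf
  refine ⟨fun i => g i x, fun i => hgS i x, fun hm => hx0 ?_, fun k => ?_⟩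
  · funext ⟨i, b⟩
    have := DFunLike.congr_fun (congrFun hm i) b.1
    simpa [hg, Finsupp.finsetSum_apply, Finsupp.single_apply, Subtype.coe_inj] using this
  · ext b
    by_cases hb : b ∈ S'
    · have := congrFun hx (k, ⟨b, hb⟩)
      simpa [f, LinearMap.sum_apply, Finsupp.finsetSum_apply] using this
    · have hmem : ∑ i, A k i (g i x) ∈ Finsupp.supported R R (S' : Set B) :=
        Submodule.sum_mem _ fun i _ => hA k i _ (hgS i x)
      by_contra hne
      exact hb (hmem (Finsupp.mem_support_iff.mpr hne))

end StrongRank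

namespace DirectedGraph

variable {V : Type*} {E : Type*} (G : DirectedGraph V E)

/-! ### Descent of the strong rank condition to the coefficient ring -/

section Descent

open Classical in
/-- The tails given by ghost paths. -/
noncomputable def ghostTails : G.Tails (V × List E) where
  base := Prod.fst
  next e d := if d.1 = G.s e then some (G.r e, e :: d.2) else none
  base_of_next {e d d'} h := by
    by_contra h'
    simp [h'] at h
  base_next {e d d'} h := by
    by_cases h' : d.1 = G.s e
    · simp only [h', if_true, Option.some.injEq] at h
      rw [← h]
    · simp [h'] at h

variable (R : Type*) [Ring R] [Fintype V]

/-- The element of the Cohn path ring given by a ghost path at a vertex. -/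
noncomputable def ghostTailElt (d : V × List E) : G.CohnPathRing R :=
  G.vertex R d.1 * (d.2.map (G.ghost R)).prod

theorem coeff_commute_ghostTailElt (a : R) (d : V × List E) :
    Commute (G.coeff R a) (G.ghostTailElt R d) := by
  refine (G.coeff_commute_vertex R a d.1).mul_right (Commute.list_prod_right _ _ fun x hx => ?_)
  obtain ⟨e, -, rfl⟩ := List.mem_map.mp hx
  exact G.coeff_commute_ghost R a e

/-- The vector corresponding to the identity element of the Cohn path ring. -/
noncomputable def unitVector (V E R : Type*) [Ring R] [Fintype V] : List E × V × List E →₀ R :=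
  ∑ v, Finsupp.single ([], v, []) 1

variable {R} in
-- Realization intertwines the actions and sends the unit vector to `∑ v = 1`. Only this left
-- inverse is needed: ghost lists that are not composable are redundant basis elements and do no
-- harm.
theorem realize_rep_unitVector (x : G.CohnPathRing R) :
    Tails.realize (G.ghostTailElt R) (G.ghostTails.rep R x (unitVector V E R)) = x := by
  obtain ⟨F, hF⟩ := G.ghostTails.exists_realize_rep x
  rw [← hF (G.ghostTailElt R) (fun d => ?_) (G.coeff_commute_ghostTailElt R) (fun e _ d => ?_)]
  · rw [unitVector, map_sum]
    simp only [Tails.realize_single, ghostTailElt, pathElt_nil, List.map_nil, List.prod_nil,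
      map_one, one_mul, mul_one, sum_vertex]
  · rw [ghostTailElt, ← mul_assoc]
    simp [ghostTails]
  · rw [ghostTailElt, ← mul_assoc]
    by_cases h : d.1 = G.s e
    · simp [ghostTails, h, ghostTailElt, ← mul_assoc]
    · rw [ghost_mul_vertex_of_ne (Ne.symm h)]
      simp [ghostTails, h]

variable {R} in
-- A solution over the Cohn path ring is applied to the unit vector. Left multiplication by
-- coefficients acts coordinatewise, so any coordinate that is nonzero for some unknown gives a
-- nonzero solution over `R`.
theorem rightStrongRankCondition_of_cohnPathRing
    (h : RightStrongRankCondition (G.CohnPathRing R)) : RightStrongRankCondition R := by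
  rw [rightStrongRankCondition_iff_matrix] at h ⊢
  intro n hn A
  obtain ⟨x, hx0, hx⟩ := h n hn (A.map (G.coeff R))
  let m (j : Fin (n + 1)) := G.ghostTails.rep R (x j) (unitVector V E R)
  obtain ⟨j, hj⟩ := Function.ne_iff.mp hx0
  have hm : m j ≠ 0 := fun hm => hj <| by
    rw [← G.realize_rep_unitVector (x j)]
    exact (congrArg _ hm).trans (map_zero _)
  obtain ⟨b, hb⟩ := Finsupp.ne_iff.mp hm
  refine ⟨fun j => m j b, fun h0 => hb (congrFun h0 j), funext fun i => ?_⟩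
  have hi : ∑ j, G.coeff R (A i j) * x j = 0 := by
    simpa [Matrix.mulVec, dotProduct] using congrFun hx i
  have hi' := congrArg (fun y => G.ghostTails.rep R y (unitVector V E R) b) hi
  simp only [map_sum, map_mul, Tails.rep_coeff, LinearMap.sum_apply, Module.End.mul_apply,
    leftMul_apply, Finsupp.finsetSum_apply, Finsupp.smul_apply, map_zero, LinearMap.zero_apply,
    Finsupp.zero_apply] at hi'
  simpa [Matrix.mulVec, dotProduct] using hi'

end Descent

/-! ### Ascent of the strong rank condition -/

section Ascent

/-- A vertex is thin if at most one edge enters each of its ancestors. -/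
def IsThin (v : V) : Prop :=
  ∀ w, G.Reaches w v → ∀ e f, G.r e = w → G.r f = w → e = f

variable {G}

/-- Induction from the end of the paths: once the remainders agree, both first edges enter the same
ancestor of `v`. -/
theorem IsPath.eq_of_length_eq {v : V} (hv : G.IsThin v) {p q : List E} {a b : V}
    (hp : G.IsPath a p v) (hq : G.IsPath b q v) (h : p.length = q.length) : p = q := by
  induction p generalizing q a b with
  | nil => exact (List.length_eq_zero_iff.mp h.symm).symm
  | cons e p ih =>
    cases q with
    | nil => simp at h
    | cons f q =>
      obtain rfl := ih hp.2 hq.2 (by simpa using h)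
      congr 1
      cases p with
      | nil => exact hv _ ⟨[], rfl⟩ e f hp.2 hq.2
      | cons e' p =>
        exact hv (G.s e') ⟨e' :: p, rfl, hp.2.2⟩ e f hp.2.1.symm hq.2.1.symm

variable (G)

/-- The paths of length less than `N` with range `v`. -/
def shortPaths (v : V) (N : ℕ) : Set (List E × Unit) :=
  {b | (∃ a, G.IsPath a b.1 v) ∧ b.1.length < N}

variable {G}

theorem shortPaths_injOn {v : V} (hv : G.IsThin v) (N : ℕ) :
    Set.InjOn (fun b : List E × Unit => b.1.length) (G.shortPaths v N) := by
  rintro ⟨p, _⟩ ⟨⟨a, hp⟩, -⟩ ⟨q, _⟩ ⟨⟨b, hq⟩, -⟩ h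
  exact Prod.ext (hp.eq_of_length_eq hv hq h) rfl

theorem shortPaths_finite {v : V} (hv : G.IsThin v) (N : ℕ) : (G.shortPaths v N).Finite :=
  Set.Finite.of_injOn (t := Set.Iio N) (fun _ hb => hb.2) (shortPaths_injOn hv N)
    (Set.finite_Iio N)

/-- Each of the lengths `N, …, N + d - 1` contributes at most one path. -/
theorem ncard_shortPaths_add_le {v : V} (hv : G.IsThin v) (N d : ℕ) :
    (G.shortPaths v (N + d)).ncard ≤ (G.shortPaths v N).ncard + d := by
  have hsub : G.shortPaths v (N + d) ⊆
      G.shortPaths v N ∪ {b ∈ G.shortPaths v (N + d) | N ≤ b.1.length} := fun b hb => by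
    rcases lt_or_ge b.1.length N with h | h
    · exact .inl ⟨hb.1, h⟩
    · exact .inr ⟨hb, h⟩
  have hle : {b ∈ G.shortPaths v (N + d) | N ≤ b.1.length}.ncard ≤ d := by
    have := Set.ncard_le_ncard_of_injOn (t := Set.Ico N (N + d))
      (s := {b ∈ G.shortPaths v (N + d) | N ≤ b.1.length}) (fun b => b.1.length)
      (fun b hb => ⟨hb.2, hb.1.2⟩) ((shortPaths_injOn hv _).mono fun b hb => hb.1)
      (Set.finite_Ico _ _)
    simpa [Set.ncard_eq_toFinset_card'] using this
  calc _ ≤ _ := Set.ncard_le_ncard hsub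
        ((shortPaths_finite hv N).union ((shortPaths_finite hv (N + d)).subset fun b hb => hb.1))
    _ ≤ _ := Set.ncard_union_le _ _
    _ ≤ _ := by omega

theorem shortPaths_mono (v : V) {M N : ℕ} (h : M ≤ N) : G.shortPaths v M ⊆ G.shortPaths v N :=
  fun _ hb => ⟨hb.1, hb.2.trans_le h⟩

theorem ncard_shortPaths_pos {v : V} (hv : G.IsThin v) {N : ℕ} (hN : 0 < N) :
    0 < (G.shortPaths v N).ncard :=
  (Set.ncard_pos (shortPaths_finite hv N)).mpr ⟨([], ()), ⟨v, rfl⟩, hN⟩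

/-- The number of paths into a thin vertex has subexponential growth. -/
theorem exists_growth_lt {v : V} (hv : G.IsThin v) (n d : ℕ) :
    ∃ N, 0 < N ∧
      n * (G.shortPaths v (N + d)).ncard < (n + 1) * (G.shortPaths v N).ncard := by
  -- Otherwise `(n+1) f(N) ≤ n f(N+d) ≤ n f(N) + n d` bounds `f` by `n d`, while the first
  -- inequality also forces `f(N+d) > f(N)`, so that `f` is unbounded.
  by_contra! h
  set f := fun N => (G.shortPaths v N).ncard with hf
  have hbound (N : ℕ) (hN : 0 < N) : f N ≤ n * d := by
    have h1 := h N hN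
    have h2 := Nat.mul_le_mul_left n (ncard_shortPaths_add_le hv N d)
    simp only [hf]
    linarith
  have hgrow (N : ℕ) (hN : 0 < N) : f N + 1 ≤ f (N + d) := by
    have h1 := h N hN
    have h2 := ncard_shortPaths_pos hv hN
    simp only [hf]
    by_contra! h3
    have h4 := Nat.mul_le_mul_left n (Nat.lt_succ_iff.mp h3)
    linarith
  have hiter (k : ℕ) : k ≤ f (1 + k * d) := by
    induction k with
    | zero => exact Nat.zero_le _
    | succ k ih =>
      have := hgrow (1 + k * d) (by omega)
      rw [show 1 + (k + 1) * d = 1 + k * d + d by ring]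
      omega
  have h1 := hiter (n * d + 1)
  have h2 := hbound (1 + (n * d + 1) * d) (by omega)
  omega

variable (G)

/-- The single tail at a vertex, which is annihilated by all ghost edges. -/
def pointTail (v : V) : G.Tails Unit where
  base _ := v
  next _ _ := none
  base_of_next h := by simp at h
  base_next h := by simp at h

variable {G}

theorem isPath_of_start_eq {v a w : V} {p : List E} {d : Unit} (hp : G.IsPath a p v)
    (h : (G.pointTail v).start (p, d) = w) : G.IsPath w p v := by
  cases p with
  | nil => exact h.symm
  | cons e p => exact ⟨h, hp.2⟩

variable {R : Type*} [Ring R] [Fintype V]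

/-- Each element of the Cohn path ring increases the lengths of paths by a bounded amount. -/
theorem exists_rep_pointTail_mem_supported (v : V) (x : G.CohnPathRing R) :
    ∃ d, ∀ d' ≥ d, ∀ N, ∀ m ∈ Finsupp.supported R R (G.shortPaths v N),
      (G.pointTail v).rep R x m ∈ Finsupp.supported R R (G.shortPaths v (N + d')) := by
  have key (φ : List E × Unit → Option (List E × Unit))
      (h : ∀ b b', (∃ a, G.IsPath a b.1 v) → φ b = some b' →
        (∃ a, G.IsPath a b'.1 v) ∧ b'.1.length ≤ b.1.length + 1) :
      ∀ d' ≥ 1, ∀ N, ∀ m ∈ Finsupp.supported R R (G.shortPaths v N),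
        transfer R φ m ∈ Finsupp.supported R R (G.shortPaths v (N + d')) := by
    intro d' hd' N m hm
    refine transfer_mem_supported φ (fun b hb b' hb' => ?_) hm
    obtain ⟨h1, h2⟩ := h b b' hb.1 hb'
    have := hb.2
    exact ⟨h1, by omega⟩
  induction x using cohn_induction with
  | coeff a =>
    refine ⟨0, fun d' _ N m hm => ?_⟩
    rw [Tails.rep_coeff, leftMul_apply]
    exact Submodule.smul_mem _ _
      (Finsupp.supported_mono (shortPaths_mono v (Nat.le_add_right N d')) hm)
  | vertex w =>
    rw [Tails.rep_vertex]
    refine ⟨1, key _ fun b b' hb h => ?_⟩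
    unfold Tails.vertexStep at h
    split_ifs at h
    cases h
    exact ⟨hb, Nat.le_succ _⟩
  | edge e =>
    rw [Tails.rep_edge]
    refine ⟨1, key _ fun b b' ⟨a, hb⟩ h => ?_⟩
    unfold Tails.edgeStep at h
    split_ifs at h with h'
    cases h
    exact ⟨⟨G.s e, rfl, isPath_of_start_eq hb h'⟩, le_rfl⟩
  | ghost e =>
    rw [Tails.rep_ghost]
    refine ⟨1, key _ fun b b' ⟨a, hb⟩ h => ?_⟩
    obtain ⟨_ | ⟨f, p⟩, d⟩ := b
    · simp [Tails.ghostStep, pointTail] at h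
    · simp only [Tails.ghostStep] at h
      split_ifs at h
      cases h
      exact ⟨⟨_, hb.2⟩, by simp only [List.length_cons]; omega⟩
  | add x y hx hy =>
    obtain ⟨d, hd⟩ := hx
    obtain ⟨d', hd'⟩ := hy
    refine ⟨max d d', fun c hc N m hm => ?_⟩
    rw [map_add, LinearMap.add_apply]
    exact Submodule.add_mem _ (hd c (le_of_max_le_left hc) N m hm)
      (hd' c (le_of_max_le_right hc) N m hm)
  | mul x y hx hy =>
    obtain ⟨d, hd⟩ := hx
    obtain ⟨d', hd'⟩ := hy
    refine ⟨d + d', fun c hc N m hm => ?_⟩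
    -- The factor `y` uses exactly `d'` and leaves `c - d' ≥ d` for `x`; allowing every larger bound
    -- also lets several elements share one.
    rw [map_mul, Module.End.mul_apply, show N + c = N + d' + (c - d') by omega]
    exact hd _ (by omega) _ _ (hd' d' le_rfl N m hm)

variable (G R)

/-- The part of a vertex that is annihilated by the ghosts of a given finite set of edges. -/
noncomputable def gap (v : V) (F : Finset E) : G.CohnPathRing R :=
  G.vertex R v * (1 - ∑ e ∈ F, G.edge R e * G.ghost R e)

variable {G R}

theorem vertex_mul_gap (v : V) (F : Finset E) : G.vertex R v * G.gap R v F = G.gap R v F := by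
  rw [gap, ← mul_assoc, vertex_mul_self]

theorem coeff_commute_gap (v : V) (F : Finset E) (a : R) :
    Commute (G.coeff R a) (G.gap R v F) :=
  (G.coeff_commute_vertex R a v).mul_right <| (Commute.one_right _).sub_right <|
    Commute.sum_right _ _ _ fun e _ =>
      (G.coeff_commute_edge R a e).mul_right (G.coeff_commute_ghost R a e)

/-- If `e` starts at `v`, then of the sum only `e⋆ e e⋆ = e⋆` survives and cancels `e⋆`; otherwise
`e⋆ v = 0` already. -/
theorem ghost_mul_gap (v : V) {F : Finset E} {e : E} (he : e ∈ F) :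
    G.ghost R e * G.gap R v F = 0 := by
  classical
  rw [gap, ← mul_assoc]
  by_cases h : G.s e = v
  · subst h
    rw [ghost_mul_source, mul_sub, mul_one, Finset.mul_sum, Finset.sum_eq_single_of_mem e he,
      ← mul_assoc, ghost_mul_edge_self, range_mul_ghost, sub_self]
    intro f _ hf
    rw [← mul_assoc, ghost_mul_edge_of_ne R hf.symm, zero_mul]
  · rw [ghost_mul_vertex_of_ne h, zero_mul]

/-- The generator of the representation on paths into `v`. -/
noncomputable def pointVector (R : Type*) [Ring R] (E : Type*) : List E × Unit →₀ R :=
  Finsupp.single ([], ()) 1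

/-- All ghost edges kill the trivial path, so the correction terms of `gap` act as zero on it and
`v` fixes it. -/
theorem rep_gap_pointVector (v : V) (F : Finset E) :
    (G.pointTail v).rep R (G.gap R v F) (pointVector R E) = pointVector R E := by
  have h (e : E) : (G.pointTail v).rep R (G.ghost R e) (pointVector R E) = 0 := by
    rw [Tails.rep_ghost, pointVector, transfer_single]
    simp [Tails.ghostStep, pointTail]
  rw [gap]
  simp only [map_mul, map_sub, map_one, map_sum, Module.End.mul_apply, LinearMap.sub_apply,
    LinearMap.sum_apply, h, map_zero, Finset.sum_const_zero, sub_zero, Module.End.one_apply]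
  rw [Tails.rep_vertex, pointVector, transfer_single]
  simp [Tails.vertexStep, Tails.start, pointTail]

theorem rep_pathElt_single {v a : V} {p : List E} (hp : G.IsPath a p v) (c : R) :
    (G.pointTail v).rep R (G.pathElt R p) (Finsupp.single ([], ()) c)
      = Finsupp.single (p, ()) c := by
  induction p generalizing a with
  | nil => simp
  | cons e p ih =>
    have h : (G.pointTail v).start (p, ()) = G.r e := by
      cases p with
      | nil => exact hp.2.symm
      | cons f p => exact hp.2.1
    rw [pathElt_cons, map_mul, Module.End.mul_apply, ih hp.2, Tails.rep_edge, transfer_single]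
    simp [Tails.edgeStep, h]

/-- This makes the lift to the ring injective on combinations of paths into `v`: evaluation at the
trivial path undoes it. -/
theorem rep_realize_gap (v : V) (F : Finset E) (N : ℕ) {m : List E × Unit →₀ R}
    (hm : m ∈ Finsupp.supported R R (G.shortPaths v N)) :
    (G.pointTail v).rep R (Tails.realize (fun _ => G.gap R v F) m) (pointVector R E) = m := by
  have hsum : m = ∑ b ∈ m.support, Finsupp.single b (m b) := m.sum_single.symm
  conv_lhs => rw [hsum]
  conv_rhs => rw [hsum]
  rw [map_sum, map_sum, LinearMap.sum_apply]
  refine Finset.sum_congr rfl fun b hb => ?_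
  obtain ⟨⟨a, ha⟩, -⟩ := hm hb
  rw [Tails.realize_single, mul_assoc, ← (coeff_commute_gap v F (m b)).eq, map_mul, map_mul,
    Module.End.mul_apply, Module.End.mul_apply, rep_gap_pointVector, Tails.rep_coeff,
    leftMul_apply, pointVector, Finsupp.smul_single, smul_eq_mul, mul_one,
    rep_pathElt_single ha]

theorem rightStrongRankCondition_cohnPathRing_of_isThin {v : V} (hv : G.IsThin v)
    (h : RightStrongRankCondition R) : RightStrongRankCondition (G.CohnPathRing R) := by
  classical
  rw [rightStrongRankCondition_iff_matrix]
  intro n hn A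
  choose d hd using fun ij : Fin n × Fin (n + 1) =>
    exists_rep_pointTail_mem_supported v (A ij.1 ij.2)
  choose F hF using fun ij : Fin n × Fin (n + 1) =>
    (G.pointTail v).exists_realize_rep (A ij.1 ij.2)
  -- One length bound and one finite set of edges that serve all entries of the matrix.
  let d₀ := Finset.univ.sup d
  let F₀ := Finset.univ.biUnion F
  obtain ⟨N, hN, hlt⟩ := exists_growth_lt hv n d₀
  have hc (N : ℕ) : (shortPaths_finite hv N).toFinset.card = (G.shortPaths v N).ncard :=
    (Set.ncard_eq_toFinset_card _ _).symm
  obtain ⟨m, hmS, hm0, hm⟩ := h.exists_supported_ker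
    (shortPaths_finite hv N).toFinset (shortPaths_finite hv (N + d₀)).toFinset
    (ι := Fin (n + 1)) (κ := Fin n)
    (by
      rw [hc, Fintype.card_fin]
      exact Nat.mul_pos hn (ncard_shortPaths_pos hv (by omega)))
    (by simpa only [hc, Fintype.card_fin] using hlt)
    (fun i j => (G.pointTail v).rep R (A i j))
    (fun i j m hm => by
      rw [Set.Finite.coe_toFinset] at hm ⊢
      exact hd (i, j) d₀ (Finset.le_sup (Finset.mem_univ (i, j))) N m hm)
  simp only [Set.Finite.coe_toFinset] at hmS
  refine ⟨fun j => Tails.realize (fun _ => G.gap R v F₀) (m j), fun h0 => hm0 ?_, ?_⟩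
  · funext j
    rw [← rep_realize_gap v F₀ N (hmS j), show Tails.realize _ (m j) = 0 from congrFun h0 j,
      map_zero]
    rfl
  · funext i
    have key (j : Fin (n + 1)) :
        A i j * Tails.realize (fun _ : Unit => G.gap R v F₀) (m j)
          = Tails.realize (fun _ => G.gap R v F₀) ((G.pointTail v).rep R (A i j) (m j)) :=
      hF (i, j) _ (fun _ => vertex_mul_gap v F₀) (fun a _ => coeff_commute_gap v F₀ a)
        (fun e he _ => ghost_mul_gap v
          (Finset.mem_biUnion.mpr ⟨(i, j), Finset.mem_univ _, he⟩)) (m j)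
    simp only [Matrix.mulVec, dotProduct, key]
    rw [← map_sum, hm i, map_zero]
    rfl

end Ascent

end DirectedGraph

namespace DirectedGraph

variable {V : Type*} {E : Type*} (G : DirectedGraph V E)

variable {G}

/-! ### Concatenation of paths and reachability -/

theorem isPath_append {a b : V} {p q : List E} :
    G.IsPath a (p ++ q) b ↔ ∃ w, G.IsPath a p w ∧ G.IsPath w q b := by
  induction p generalizing a with
  | nil => simp [IsPath]
  | cons e p ih => simp [IsPath, ih, and_assoc]

theorem Reaches.refl (v : V) : G.Reaches v v := ⟨[], rfl⟩

theorem Reaches.trans {a b c : V} (h : G.Reaches a b) (h' : G.Reaches b c) : G.Reaches a c := by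
  obtain ⟨p, hp⟩ := h
  obtain ⟨q, hq⟩ := h'
  exact ⟨p ++ q, isPath_append.mpr ⟨b, hp, hq⟩⟩

theorem reaches_edge (e : E) : G.Reaches (G.s e) (G.r e) := ⟨[e], rfl, rfl⟩

/-- Nonemptiness matters: the empty list is a path at every vertex. -/
theorem IsPath.range_unique {a a' b b' : V} {p : List E} (hne : p ≠ [])
    (h : G.IsPath a p b) (h' : G.IsPath a' p b') : b = b' := by
  cases p with
  | nil => exact absurd rfl hne
  | cons e p =>
    replace h := h.2
    replace h' := h'.2
    clear hne
    induction p generalizing e with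
    | nil => exact h.symm.trans h'
    | cons f p ih => exact ih f h.2 h'.2

theorem IsPath.exists_range {a v : V} {p : List E} (hp : G.IsPath a p v) (hne : p ≠ []) :
    ∃ e, G.r e = v := by
  rcases List.eq_nil_or_concat' p with rfl | ⟨q, e, rfl⟩
  · exact absurd rfl hne
  · obtain ⟨u, -, hu⟩ := isPath_append.mp hp
    exact ⟨e, hu.2⟩

/-! ### Embedding two copies of the ring when no vertex is thin -/

/-- Incoming edges are prepended one at a time; this pads paths to a common length without changing
their endings. -/
theorem exists_isPath_length (hr : ∀ w, ∃ e, G.r e = w) {a v : V} {p : List E}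
    (hp : G.IsPath a p v) (k : ℕ) :
    ∃ q b, q.length = k ∧ G.IsPath b (q ++ p) v := by
  induction k with
  | zero => exact ⟨[], a, rfl, hp⟩
  | succ k ih =>
    obtain ⟨q, b, hq, hb⟩ := ih
    obtain ⟨e, he⟩ := hr b
    exact ⟨e :: q, G.s e, by simp [hq], rfl, by rwa [he]⟩

/-- If no vertex is thin, then two distinct paths of the same length end at each vertex, where the
length does not depend on the vertex. -/
theorem exists_injective_paths [Finite V] (h : ∀ v, ¬ G.IsThin v) :
    ∃ (N : ℕ) (p : V × Bool → List E), Injective p ∧ (∀ i, (p i).length = N) ∧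
      ∀ i, ∃ a, G.IsPath a (p i) i.1 := by
  have := Fintype.ofFinite V
  have h' (v : V) : ∃ (q : List E) (e f : E), e ≠ f ∧ G.r e = G.r f ∧ G.IsPath (G.r e) q v := by
    have := h v
    unfold IsThin at this
    push Not at this
    obtain ⟨w, ⟨q, hq⟩, e, f, he, hf, hne⟩ := this
    exact ⟨q, e, f, hne, he.trans hf.symm, he ▸ hq⟩
  choose q e f hne hr hq using h'
  have hin (w : V) : ∃ e, G.r e = w :=
    IsPath.exists_range (a := G.s (e w)) (p := e w :: q w) ⟨rfl, hq w⟩ (by simp)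
  -- Padding in front by `N - |q|` edges makes every path, consisting of padding, one of the two
  -- edges and `q`, have length `N + 1`.
  let N := Finset.univ.sup (fun v => (q v).length)
  have hN (v : V) : (q v).length ≤ N := Finset.le_sup (f := fun v => (q v).length)
    (Finset.mem_univ v)
  have hlong (i : V × Bool) : ∃ l b, l.length = N - (q i.1).length ∧
      G.IsPath b (l ++ ((if i.2 then e i.1 else f i.1) :: q i.1)) i.1 := by
    refine exists_isPath_length hin (a := G.s (if i.2 then e i.1 else f i.1))
      (p := (if i.2 then e i.1 else f i.1) :: q i.1) ⟨rfl, ?_⟩ _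
    split_ifs
    · exact hq i.1
    · exact hr i.1 ▸ hq i.1
  choose l b hl hb using hlong
  refine ⟨N + 1, fun i => l i ++ ((if i.2 then e i.1 else f i.1) :: q i.1), ?_, fun i => ?_,
    fun i => ⟨b i, hb i⟩⟩
  · rintro ⟨v, x⟩ ⟨w, y⟩ hvw
    have hbv := hb (v, x)
    dsimp only at hvw hbv
    rw [hvw] at hbv
    -- The path determines its range, hence `v`; the endings after the padding then have the same
    -- length, and comparing their first edges determines the Boolean.
    obtain rfl : v = w := hbv.range_unique (by simp) (hb (w, y))
    have := (List.append_inj' hvw (by simp)).2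
    cases x <;> cases y
    · rfl
    · exact absurd (List.cons.inj this).1 (hne v).symm
    · exact absurd (List.cons.inj this).1 (hne v)
    · rfl
  · have := hN i.1
    simp only [List.length_append, List.length_cons, hl]
    omega

variable {R : Type*} [Ring R] [Fintype V]

theorem vertex_mul_pathElt {a v : V} {p : List E} (hp : G.IsPath a p v) :
    G.vertex R a * (G.pathElt R p * G.vertex R v) = G.pathElt R p * G.vertex R v := by
  cases p with
  | nil => obtain rfl : a = v := hp; simp
  | cons e p => obtain rfl := hp.1; simp [← mul_assoc]

variable (G R) in
/-- The product of the ghost edges of a path. -/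
noncomputable def ghostElt (p : List E) : G.CohnPathRing R := (p.reverse.map (G.ghost R)).prod

theorem ghostElt_cons (e : E) (p : List E) :
    G.ghostElt R (e :: p) = G.ghostElt R p * G.ghost R e := by simp [ghostElt]

theorem ghostElt_mul_pathElt_self {a v : V} {p : List E} (hp : G.IsPath a p v) :
    G.ghostElt R p * (G.pathElt R p * G.vertex R v) = G.vertex R v := by
  induction p generalizing a with
  | nil => simp [ghostElt]
  | cons e p ih =>
    rw [ghostElt_cons, pathElt_cons, mul_assoc, mul_assoc, ← mul_assoc (G.ghost R e),
      ghost_mul_edge_self, vertex_mul_pathElt hp.2, ih hp.2]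

/-- By equality of lengths neither path is a proper initial segment of the other, so the
cancellation reaches two different edges. -/
theorem ghostElt_mul_pathElt_of_ne {a v : V} {p q : List E} (hp : G.IsPath a p v)
    (hne : q ≠ p) (hl : q.length = p.length) :
    G.ghostElt R q * (G.pathElt R p * G.vertex R v) = 0 := by
  induction p generalizing a q with
  | nil => exact absurd (List.length_eq_zero_iff.mp hl) hne
  | cons e p ih =>
    cases q with
    | nil => simp at hl
    | cons f q =>
      rw [ghostElt_cons, pathElt_cons, mul_assoc, mul_assoc, ← mul_assoc (G.ghost R f)]
      by_cases h : f = e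
      · subst h
        rw [ghost_mul_edge_self, vertex_mul_pathElt hp.2,
          ih hp.2 (fun h => hne (h ▸ rfl)) (by simpa using hl)]
      · rw [ghost_mul_edge_of_ne R h, zero_mul, mul_zero]

/-- With `g b` the sum over `v` of the chosen paths, the embedding is `(x, y) ↦ g false * x + g true
* y`: multiplication by the ghost of the path chosen for `(v, b)` isolates `v * x` or `v * y`, and
the vertices sum to `1`. -/
theorem exists_injective_of_forall_not_isThin (h : ∀ v, ¬ G.IsThin v) :
    ∃ f : (G.CohnPathRing R × G.CohnPathRing R) →ₗ[(G.CohnPathRing R)ᵐᵒᵖ] G.CohnPathRing R,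
      Injective f := by
  classical
  obtain ⟨N, p, hp, hN, hpath⟩ := exists_injective_paths h
  choose a ha using hpath
  let g (b : Bool) : G.CohnPathRing R := ∑ v, G.pathElt R (p (v, b)) * G.vertex R v
  have hg (b c : Bool) (v : V) :
      G.ghostElt R (p (v, c)) * g b = if c = b then G.vertex R v else 0 := by
    simp only [g, Finset.mul_sum]
    have h1 (w : V) : G.ghostElt R (p (v, c)) * (G.pathElt R (p (w, b)) * G.vertex R w)
        = if (v, c) = (w, b) then G.vertex R w else 0 := by
      split_ifs with h
      · rw [h]
        exact ghostElt_mul_pathElt_self (ha (w, b))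
      · exact ghostElt_mul_pathElt_of_ne (ha (w, b)) (fun h' => h (hp h')) (by rw [hN, hN])
    simp only [h1]
    split_ifs with hcb <;> simp [hcb]
  let f : (G.CohnPathRing R × G.CohnPathRing R) →ₗ[(G.CohnPathRing R)ᵐᵒᵖ] G.CohnPathRing R :=
    { toFun := fun x => g false * x.1 + g true * x.2
      map_add' := fun x y => by simp only [Prod.fst_add, Prod.snd_add, mul_add]; abel
      map_smul' := fun c x => by simp [mul_assoc] }
  refine ⟨f, (injective_iff_map_eq_zero f).mpr fun x hx => ?_⟩
  replace hx : g false * x.1 + g true * x.2 = 0 := hx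
  have hv (c : Bool) (v : V) : G.vertex R v * (if c then x.2 else x.1) = 0 := by
    have := congrArg (G.ghostElt R (p (v, c)) * ·) hx
    simp only [mul_add, ← mul_assoc, hg, mul_zero] at this
    cases c <;> simpa using this
  have h0 (c : Bool) : (if c then x.2 else x.1) = 0 := by
    rw [← one_mul (if c then x.2 else x.1), ← sum_vertex, Finset.sum_mul]
    exact Finset.sum_eq_zero fun v _ => hv c v
  exact Prod.ext (by simpa using h0 false) (by simpa using h0 true)

end DirectedGraph

namespace DirectedGraph

variable {V : Type*} {E : Type*} {G : DirectedGraph V E}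

/-! ### Cycles and thin vertices -/

theorem IsPath.cons_map_r {a b : V} {p : List E} (hp : G.IsPath a p b) :
    a :: p.map G.r = p.map G.s ++ [b] := by
  induction p generalizing a with
  | nil => exact congrArg (fun x => [x]) hp
  | cons e p ih =>
    obtain ⟨rfl, hp⟩ := hp
    simp [ih hp]

/-- Along a closed path, distinct sources thus force distinct ranges, so that a cycle enters each of
its vertices by only one of its edges. -/
theorem IsPath.perm_map_r {a : V} {p : List E} (hp : G.IsPath a p a) :
    (p.map G.r).Perm (p.map G.s) := by
  have h := hp.cons_map_r
  exact (List.perm_cons a).mp (h ▸ List.perm_append_singleton a (p.map G.s))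

theorem IsCycle.mem_vert_iff {c : List E} (hc : G.IsCycle c) {v : V} :
    v ∈ G.vert c ↔ ∃ e ∈ c, G.s e = v := by
  obtain ⟨-, ⟨a, ha⟩, -⟩ := hc
  have hperm (w : V) : (∃ e ∈ c, G.r e = w) ↔ ∃ e ∈ c, G.s e = w := by
    simpa using ha.perm_map_r.mem_iff (a := w)
  constructor
  · rintro ⟨e, he, rfl | rfl⟩
    · exact ⟨e, he, rfl⟩
    · exact (hperm _).mp ⟨e, he, rfl⟩
  · rintro ⟨e, he, rfl⟩
    exact ⟨e, he, .inl rfl⟩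

theorem IsCycle.mem_vert_iff' {c : List E} (hc : G.IsCycle c) {v : V} :
    v ∈ G.vert c ↔ ∃ e ∈ c, G.r e = v := by
  rw [hc.mem_vert_iff]
  obtain ⟨-, ⟨a, ha⟩, -⟩ := hc
  simpa using (ha.perm_map_r.mem_iff (a := v)).symm

theorem IsCycle.injOn_r {c : List E} (hc : G.IsCycle c) {e f : E} (he : e ∈ c) (hf : f ∈ c)
    (h : G.r e = G.r f) : e = f := by
  obtain ⟨-, ⟨a, ha⟩, hnd⟩ := hc
  exact List.inj_on_of_nodup_map (ha.perm_map_r.nodup_iff.mpr hnd) he hf h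

/-- A cycle can be rotated so that it starts at any one of its vertices. -/
theorem IsCycle.exists_rotated {c : List E} (hc : G.IsCycle c) {v : V} (hv : v ∈ G.vert c) :
    ∃ c', c'.IsRotated c ∧ G.IsPath v c' v := by
  obtain ⟨e, he, rfl⟩ := hc.mem_vert_iff.mp hv
  obtain ⟨-, ⟨a, ha⟩, -⟩ := hc
  obtain ⟨p, q, rfl⟩ := List.append_of_mem he
  obtain ⟨w, hp, hq⟩ := isPath_append.mp ha
  refine ⟨e :: q ++ p, List.isRotated_append, isPath_append.mpr ⟨a, ⟨rfl, hq.2⟩, ?_⟩⟩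
  rwa [hq.1]

theorem IsCycle.reaches {c : List E} (hc : G.IsCycle c) {v w : V} (hv : v ∈ G.vert c)
    (hw : w ∈ G.vert c) : G.Reaches v w := by
  obtain ⟨c', hc', hp⟩ := hc.exists_rotated hv
  obtain ⟨e, he, rfl⟩ := hc.mem_vert_iff.mp hw
  obtain ⟨p, q, rfl⟩ := List.append_of_mem (hc'.mem_iff.mpr he)
  obtain ⟨u, hp, hq⟩ := isPath_append.mp hp
  exact ⟨p, hq.1 ▸ hp⟩

/-- A closed path at a thin vertex that visits it only once is unique. -/
theorem IsPath.eq_of_nodup {x : V} (hx : G.IsThin x) {p q : List E} (hp : G.IsPath x p x)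
    (hq : G.IsPath x q x) (hpn : p ≠ []) (hnd : (q.map G.s).Nodup) (hle : p.length ≤ q.length) :
    p = q := by
  -- Thinness identifies `p` with the final segment `m` of `q`. If `l` were nonempty, `x` would be
  -- the source of the first edges of both `l` and `m`.
  obtain ⟨l, m, rfl, hm⟩ : ∃ l m, q = l ++ m ∧ m.length = p.length :=
    ⟨q.take (q.length - p.length), q.drop (q.length - p.length), by simp, by simp; omega⟩
  obtain ⟨u, hl, hmp⟩ := isPath_append.mp hq
  obtain rfl := hp.eq_of_length_eq hx hmp hm.symm
  cases p with
  | nil => exact absurd rfl hpn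
  | cons f p =>
    cases l with
    | nil => rfl
    | cons e l =>
      rw [List.map_append, List.nodup_append] at hnd
      exact absurd (hl.1.trans hp.1.symm) (hnd.2.2 _ (by simp) _ (by simp))

/-- Vertices that are connected by a path are connected by a path without repetitions. -/
theorem Reaches.exists_simple {a b : V} (h : G.Reaches a b) :
    ∃ p, G.IsPath a p b ∧ (p.map G.s).Nodup ∧ b ∉ p.map G.s := by
  classical
  obtain ⟨p, hp⟩ := h
  induction p generalizing a with
  | nil => exact ⟨[], hp, by simp⟩
  | cons e p ih =>
    obtain ⟨rfl, hp⟩ := hp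
    obtain ⟨q, hq, hnd, hb⟩ := ih hp
    by_cases hab : G.s e = b
    · exact ⟨[], hab, by simp⟩
    by_cases hmem : G.s e ∈ q.map G.s
    -- The simple path `q` returns to the source of `e`; the loop is cut off by starting at that
    -- visit.
    · obtain ⟨f, hf, hfe⟩ := List.mem_map.mp hmem
      obtain ⟨l, m, rfl⟩ := List.append_of_mem hf
      obtain ⟨w, -, hm⟩ := isPath_append.mp hq
      rw [List.map_append] at hnd hb
      exact ⟨f :: m, ⟨hfe, hm.2⟩, (List.nodup_append.mp hnd).2.1,
        fun h => hb (List.mem_append_right _ h)⟩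
    · exact ⟨e :: q, ⟨rfl, hq⟩, List.nodup_cons.mpr ⟨hmem, hnd⟩, by
        simpa [Ne.symm hab] using hb⟩

/-- An edge whose range reaches its source is the first edge of a cycle. -/
theorem exists_isCycle_cons {e : E} (h : G.Reaches (G.r e) (G.s e)) :
    ∃ p, G.IsCycle (e :: p) := by
  obtain ⟨p, hp, hnd, hs⟩ := h.exists_simple
  exact ⟨p, by simp, ⟨G.s e, rfl, hp⟩, List.nodup_cons.mpr ⟨hs, hnd⟩⟩

/-- If every ancestor of `v` has an incoming edge, then `v` is reached by a cycle. -/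
theorem exists_cycle_of_no_source [Finite V] {v : V}
    (h : ∀ w, G.Reaches w v → ∃ e, G.r e = w) :
    ∃ c, G.IsCycle c ∧ ∃ w ∈ G.vert c, G.Reaches w v := by
  -- Strict reachability is well founded on a finite vertex set. An edge into a minimal ancestor
  -- must start in the same strongly connected component, and so it lies on a cycle.
  let r : V → V → Prop := fun a b => G.Reaches a b ∧ ¬ G.Reaches b a
  have : IsTrans V r := ⟨fun a b c hab hbc =>
    ⟨hab.1.trans hbc.1, fun hca => hab.2 (hbc.1.trans hca)⟩⟩
  have : Std.Irrefl r := ⟨fun a ha => ha.2 ha.1⟩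
  obtain ⟨w, hw, hmin⟩ := (Finite.wellFounded_of_trans_of_irrefl r).has_min
    {w | G.Reaches w v} ⟨v, .refl v⟩
  obtain ⟨e, rfl⟩ := h w hw
  have hback : G.Reaches (G.r e) (G.s e) := by
    by_contra hno
    exact hmin (G.s e) ((reaches_edge e).trans hw) ⟨reaches_edge e, hno⟩
  obtain ⟨p, hp⟩ := exists_isCycle_cons hback
  exact ⟨e :: p, hp, G.r e, ⟨e, by simp, .inr rfl⟩, hw⟩

theorem reaches_source_eq {w : V} (hw : ∀ e, G.r e ≠ w) {a : V} (h : G.Reaches a w) : a = w := by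
  obtain ⟨p, hp⟩ := h
  by_contra hne
  obtain ⟨e, he⟩ := hp.exists_range fun h => hne (by subst h; exact hp)
  exact hw e he

/-- No path from another vertex ends at a source and no cycle passes through it, so its complement
is hereditary and contains all cycles. -/
theorem cycleHereditaryClosure_ne_univ_of_source {w : V} (hw : ∀ e, G.r e ≠ w) :
    G.cycleHereditaryClosure ≠ Set.univ := by
  intro h
  have hle : G.cycleHereditaryClosure ⊆ {w}ᶜ := by
    refine G.isLeast_cycleHereditaryClosure.2 ⟨fun x hx v hv hvw => ?_, ?_⟩
    · obtain rfl : v = w := hvw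
      exact hx (reaches_source_eq hw hv)
    · rintro v ⟨c, hc, hv⟩ rfl
      obtain ⟨e, -, he⟩ := hc.mem_vert_iff'.mp hv
      exact hw e he
  exact hle (h ▸ Set.mem_univ w) rfl

/-- Without sources, every vertex is reached by a cycle and so lies in the closure. -/
theorem exists_source_of_cycleHereditaryClosure_ne_univ [Finite V]
    (h : G.cycleHereditaryClosure ≠ Set.univ) : ∃ w, ∀ e, G.r e ≠ w := by
  obtain ⟨v, hv⟩ := (Set.ne_univ_iff_exists_notMem _).mp h
  by_contra! hno
  obtain ⟨c, hc, w, hw, hwv⟩ := exists_cycle_of_no_source (v := v) fun w _ => hno w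
  have hX := G.isLeast_cycleHereditaryClosure.1
  exact hv (hX.1 w (hX.2 ⟨c, hc, hw⟩) v hwv)

theorem isThin_of_source {w : V} (hw : ∀ e, G.r e ≠ w) : G.IsThin w := by
  intro a ha e _ he _
  obtain rfl := reaches_source_eq hw ha
  exact absurd he (hw e)

/-- An edge that leaves a vertex of the cycle and can return lies on a cycle through that vertex,
which by exclusivity is a rotation of `c`. -/
theorem IsExclusiveCycle.mem_of_reaches {c : List E} (hc : G.IsExclusiveCycle c) {e : E}
    (he : G.s e ∈ G.vert c) (h : G.Reaches (G.r e) (G.s e)) : e ∈ c := by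
  obtain ⟨p, hp⟩ := exists_isCycle_cons h
  have := hc.2 _ hp ⟨G.s e, he, e, by simp, .inl rfl⟩
  exact this.mem_iff.mp (by simp)

/-- The vertices that are strongly connected to an exclusive cycle lie on it. -/
theorem IsExclusiveCycle.mem_vert {c : List E} (hc : G.IsExclusiveCycle c) {x u : V}
    (hx : x ∈ G.vert c) (hxu : G.Reaches x u) (hux : G.Reaches u x) : u ∈ G.vert c := by
  obtain ⟨p, hp⟩ := hxu
  induction p generalizing x with
  | nil => exact hp ▸ hx
  | cons e p ih =>
    obtain ⟨rfl, hp⟩ := hp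
    have he := hc.mem_of_reaches hx (Reaches.trans ⟨p, hp⟩ hux)
    exact ih ⟨e, he, .inr rfl⟩ (hux.trans (reaches_edge e)) hp

/-- Thin vertices exist if and only if there is a vertex outside the hereditary closure of the
cycles or an exclusive maximal cycle. -/
theorem exists_isThin_iff [Finite V] : (∃ v, G.IsThin v) ↔
    G.cycleHereditaryClosure ≠ Set.univ ∨ ∃ c, G.IsExclusiveCycle c ∧ G.IsMaximalCycle c := by
  constructor
  · rintro ⟨v, hv⟩
    rw [or_iff_not_imp_left]
    intro hX
    have hin (w : V) : ∃ e, G.r e = w := by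
      by_contra! hw
      exact hX (cycleHereditaryClosure_ne_univ_of_source hw)
    obtain ⟨c, hc, w, hw, hwv⟩ := exists_cycle_of_no_source fun w (_ : G.Reaches w v) => hin w
    have hcv {x : V} (hx : x ∈ G.vert c) : G.Reaches x v := (hc.reaches hx hw).trans hwv
    -- Going backwards never leaves `c`: by thinness, the only edge into a vertex of `c` is the one
    -- on `c`. This gives maximality.
    have hback {y z : V} (hyz : G.Reaches y z) (hz : z ∈ G.vert c) : y ∈ G.vert c := by
      obtain ⟨p, hp⟩ := hyz
      induction p generalizing y with
      | nil => exact (show y = z from hp) ▸ hz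
      | cons e p ih =>
        obtain ⟨f, hf, hfe⟩ := hc.mem_vert_iff'.mp (ih hp.2)
        obtain rfl := hv _ (hcv (ih hp.2)) f e hfe rfl
        exact ⟨f, hf, .inl hp.1.symm⟩
    refine ⟨c, ⟨hc, ?_⟩, hc, ?_⟩
    · rintro d hd ⟨x, hxc, hxd⟩
      have hx : G.IsThin x := fun u hu => hv u (hu.trans (hcv hxc))
      obtain ⟨c', hc', hpc⟩ := hc.exists_rotated hxc
      obtain ⟨d', hd', hpd⟩ := hd.exists_rotated hxd
      have hcn : c' ≠ [] := fun h => hc.1 (by simpa [h] using hc'.symm)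
      have hdn : d' ≠ [] := fun h => hd.1 (by simpa [h] using hd'.symm)
      have hcnd : (c'.map G.s).Nodup := (hc'.perm.map G.s).nodup_iff.mpr hc.2.2
      have hdnd : (d'.map G.s).Nodup := (hd'.perm.map G.s).nodup_iff.mpr hd.2.2
      have hcd : d' = c' := by
        rcases le_total c'.length d'.length with hle | hle
        · exact (hpc.eq_of_nodup hx hpd hcn hdnd hle).symm
        · exact hpd.eq_of_nodup hx hpc hdn hcnd hle
      exact hd'.symm.trans (hcd ▸ hc')
    · rintro d hd ⟨y, hy, z, hz, hyz⟩
      exact ⟨y, hback hyz hz, y, hy, .refl y⟩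
  · rintro (h | ⟨c, hc, hmax⟩)
    · obtain ⟨w, hw⟩ := exists_source_of_cycleHereditaryClosure_ne_univ h
      exact ⟨w, isThin_of_source hw⟩
    · obtain ⟨v, hv⟩ : (G.vert c).Nonempty := by
        obtain ⟨e, he⟩ := List.exists_mem_of_ne_nil c hc.1.1
        exact ⟨G.s e, e, he, .inl rfl⟩
      -- A source is itself thin. Without sources, every ancestor of `v` is reached by a cycle, to
      -- which maximality of `c` applies.
      by_cases hin : ∃ w, ∀ e, G.r e ≠ w
      · obtain ⟨w, hw⟩ := hin
        exact ⟨w, isThin_of_source hw⟩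
      push Not at hin
      -- Maximality returns from `c` to the cycle above `u`, so `u` is strongly connected to `c` and
      -- lies on it by exclusivity.
      have hback {u : V} (hu : G.Reaches u v) : u ∈ G.vert c := by
        obtain ⟨d, hd, x, hx, hxu⟩ := exists_cycle_of_no_source fun w (_ : G.Reaches w u) => hin w
        obtain ⟨y, hy, z, hz, hyz⟩ := hmax.2 d hd ⟨x, hx, v, hv, hxu.trans hu⟩
        exact hc.mem_vert hv
          ((((hc.1.reaches hv hy).trans hyz).trans (hd.reaches hz hx)).trans hxu) hu
      refine ⟨v, fun w hw e f he hf => ?_⟩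
      have hmem {e : E} (he : G.r e = w) : e ∈ c := by
        subst he
        have hs := hback ((reaches_edge e).trans hw)
        exact hc.mem_of_reaches hs (hc.1.reaches (hback hw) hs)
      exact hc.1.injOn_r (hmem he) (hmem hf) (he.trans hf.symm)

end DirectedGraph

theorem corollary4p10 {R : Type*} [Ring R] {V : Type*} {E : Type*} [Fintype V]
    (G : DirectedGraph V E) :
    List.TFAE [
      RightStrongRankCondition (G.CohnPathRing R),
      RightStrongRankCondition R ∧
        ¬ ∃ f : (G.CohnPathRing R × G.CohnPathRing R) →ₗ[(G.CohnPathRing R)ᵐᵒᵖ] G.CohnPathRing R,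
          Injective f,
      RightStrongRankCondition R ∧
        (G.cycleHereditaryClosure ≠ Set.univ ∨
          ∃ c : List E, G.IsExclusiveCycle c ∧ G.IsMaximalCycle c)] := by
  rw [← DirectedGraph.exists_isThin_iff]
  tfae_have 1 → 2 := fun h => by
    refine ⟨G.rightStrongRankCondition_of_cohnPathRing h, fun ⟨f, hf⟩ => ?_⟩
    have hp := (LinearEquiv.finTwoArrow (G.CohnPathRing R)ᵐᵒᵖ (G.CohnPathRing R)).injective
    have hu := (LinearEquiv.funUnique (Fin 1) (G.CohnPathRing R)ᵐᵒᵖ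
      (G.CohnPathRing R)).symm.injective
    -- The case `n = 1`, with `C ⊕ C` and `C` identified with functions on `Fin 2` and `Fin 1`.
    exact h 1 one_pos ⟨(LinearEquiv.funUnique (Fin 1) (G.CohnPathRing R)ᵐᵒᵖ
      (G.CohnPathRing R)).symm.toLinearMap ∘ₗ f ∘ₗ
      (LinearEquiv.finTwoArrow (G.CohnPathRing R)ᵐᵒᵖ (G.CohnPathRing R)).toLinearMap,
      hu.comp (hf.comp hp)⟩
  tfae_have 2 → 3 := fun h => by
    refine ⟨h.1, ?_⟩
    by_contra! hno
    exact h.2 (DirectedGraph.exists_injective_of_forall_not_isThin hno)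
  tfae_have 3 → 1 := fun ⟨h, v, hv⟩ =>
    DirectedGraph.rightStrongRankCondition_cohnPathRing_of_isThin hv h
  tfae_finish
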